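/- Let $N\ge 2$ and let $M:\mathbb C\to\mathbb C^{N\times N}$ be an entire matrix-valued function such that (i) $M(z)\,J\,M(\bar z)^*=J$ for all $z\in\mathbb C$, for some unitary matrix $J$; (ii) if $M(z)$ has an eigenvalue of modulus $1$, then $z\in\mathbb R$. Put $L(z)=\frac12(M(z)+M(z)^{-1})$ and $\Phi(\nu,z)=\det(L(z)-\nu I_N)$. Let $z_0\in\mathbb R$, and let $\Delta_1,\dots,\Delta_\varkappa$ be branches of the zeros of $\Phi(\cdot,z)$ which have $z_0$ as a common branch point. That is, $\varkappa\ge2$, and $\Delta_1,\dots,\Delta_\varkappa$ are all the distinct branches, numbered cyclically, which arise from one analytic branch of the zeros of $\Phi(\cdot,z)$ by analytic continuation around $z_0$ in a punctured disc $\{0<|z-z_0|<R\}$ (in which it can be continued along every path); they are regarded as single-valued functions on the disc cut along the vertical segment going down from $z_0$. Assume that for some $\varepsilon>0$ either all $\Delta_j(z)$ are real for all $z\in(z_0,z_0+\varepsilon)$, or all $\Delta_j(z)$ are real for all $z\in(z_0-\varepsilon,z_0)$. Then $\varkappa=2$; $z_0$ is a branch point of order $\frac12$ of $\Delta_1$ and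 of $\Delta_2$ (near $z_0$ each is a convergent power series in $(z-z_0)^{1/2}$, but not one in $z-z_0$); and there is an integer $m\ge0$ such that $(\Delta_1-\Delta_2)^2$ is (that is, extends to be) analytic in a disc $\{|z-z_0|<r\}$ for some small $r>0$ and has at $z_0$ a zero of multiplicity exactly $2m+1$. If in addition $\Delta_1(z_0):=\lim_{z\to z_0}\Delta_1(z)\in(-1,1)$, then $m=0$. -/

import Mathlib

/-- The class of monodromy matrices: `M` is an entire `N × N` matrix-valued function such that
`M(z) J M(z̄)* = J` for all `z`, with some unitary matrix `J`, and such that an eigenvalue of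
`M(z)` can lie on the unit circle only when `z` is real. -/
structure IsMonodromy {N : ℕ} (M : ℂ → Matrix (Fin N) (Fin N) ℂ) : Prop where
  entire : ∀ i j, Differentiable ℂ (fun z => M z i j)
  unitary_identity : ∃ J ∈ Matrix.unitaryGroup (Fin N) ℂ, ∀ z : ℂ,
    M z * J * (M (starRingEnd ℂ z)).conjTranspose = J
  real_of_norm_eq_one : ∀ z τ : ℂ, τ ∈ spectrum ℂ (M z) → ‖τ‖ = 1 → z.im = 0

/-- `L(z) = (M(z) + M(z)⁻¹) / 2`. -/
noncomputable def lyapunovMatrix {N : ℕ} (M : ℂ → Matrix (Fin N) (Fin N) ℂ) (z : ℂ) :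
    Matrix (Fin N) (Fin N) ℂ :=
  (1 / 2 : ℂ) • (M z + (M z)⁻¹)

/-- `Φ(ν, z) = det (L(z) - ν I)`. -/
noncomputable def lyapunovDet {N : ℕ} (M : ℂ → Matrix (Fin N) (Fin N) ℂ) (ν z : ℂ) : ℂ :=
  (lyapunovMatrix M z - ν • (1 : Matrix (Fin N) (Fin N) ℂ)).det

/-- The disc of radius `r` about `c`, with the vertical segment going down from `c`
(including `c`) removed. When `c` is real, it contains the real points of the disc on both
sides of `c`. -/
def cutDisc (c : ℂ) (r : ℝ) : Set ℂ :=
  {z | ‖z - c‖ < r ∧ ¬ (z.re = c.re ∧ z.im ≤ c.im)}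

/-- The branch of the logarithm with imaginary part in `(-π/2, 3π/2]`; it is holomorphic outside
the half-line going down from `0`. -/
noncomputable def cutLog (w : ℂ) : ℂ :=
  Complex.log (-Complex.I * w) + (Real.pi / 2 : ℂ) * Complex.I

/-- `Δ 0, …, Δ (ϰ - 1)` have the branch point `z₀`: they are the single-valued branches in the
disc of radius `r` about `z₀`, cut from `z₀` downwards, of one multivalued analytic function on
the punctured disc whose values are zeros of `Φ(·, z)`. This function is written as
`G (log (z - z₀))`, with `G` holomorphic on the half-plane `{w | |exp w| < r}`, so that adding
`2πi` to the variable is analytic continuation once around `z₀`. It has exactly `ϰ` branches,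
and at least two: `ϰ ≥ 2` turns restore `G` and fewer do not. -/
def IsBranchCycle {N : ℕ} (M : ℂ → Matrix (Fin N) (Fin N) ℂ) (z₀ : ℂ) (r : ℝ)
    (ϰ : ℕ) (Δ : Fin ϰ → ℂ → ℂ) : Prop :=
  2 ≤ ϰ ∧ ∃ G : ℂ → ℂ,
    DifferentiableOn ℂ G {w | ‖Complex.exp w‖ < r} ∧
    (∀ w : ℂ, ‖Complex.exp w‖ < r → lyapunovDet M (G w) (z₀ + Complex.exp w) = 0) ∧
    (∀ w : ℂ, ‖Complex.exp w‖ < r → G (w + 2 * Real.pi * Complex.I * (ϰ : ℂ)) = G w) ∧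
    (∀ k : ℕ, 0 < k → k < ϰ →
      ∃ w : ℂ, ‖Complex.exp w‖ < r ∧ G (w + 2 * Real.pi * Complex.I * (k : ℂ)) ≠ G w) ∧
    (∀ j : Fin ϰ, ∀ z ∈ cutDisc z₀ r,
      Δ j z = G (cutLog (z - z₀) + 2 * Real.pi * Complex.I * ((j : ℕ) : ℂ)))

/-- Near `z₀` (off the cut) `f` is a convergent power series in `(z - z₀)^(1/p)`. -/
def HasPuiseuxSeries (f : ℂ → ℂ) (z₀ : ℂ) (p : ℕ) : Prop :=
  ∃ F : ℂ → ℂ, AnalyticAt ℂ F 0 ∧ ∃ r : ℝ, 0 < r ∧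
    ∀ z ∈ cutDisc z₀ r, f z = F (Complex.exp (cutLog (z - z₀) / (p : ℂ)))

/-- `z₀` is a branch point of order `1/p` of the branch `f`: `f` is a power series in
`(z - z₀)^(1/p)`, with `p ≥ 2` the least possible. -/
def HasBranchPointOfOrderOneOver (f : ℂ → ℂ) (z₀ : ℂ) (p : ℕ) : Prop :=
  2 ≤ p ∧ HasPuiseuxSeries f z₀ p ∧ ∀ q : ℕ, 0 < q → q < p → ¬ HasPuiseuxSeries f z₀ q

open Complex Filter Topology Metric

/-! Zeros of `Φ(·, z)` are locally bounded, so in `ζ = (z - z₀)^(1/ϰ)` the singularity is removable: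
the branches are `F(ω^j ζ)` for one analytic germ `F`, with `ω = exp(2πi/ϰ)`
(`IsBranchCycle.exists_germ`). On the real side `ζ = η t` with `t > 0`, where `η = exp(iθ/ϰ)` and
`θ` is `0` or `π`. Thus `f(ζ) = F(ηζ)` is real on the rays through `1` and `ω`. Reflecting in both
rays gives `f(ω²ζ) = f(ζ)`, so two turns restore the function and `ϰ = 2`.

Now the branches differ by `±(F(ζ) - F(-ζ))`, a nonzero odd germ, whose order is some `2m + 1`. Its
square is even of order `2(2m + 1)` in `ζ`, hence analytic of order `2m + 1` in `z`.

If `F(0) ∈ (-1, 1)`, a real value of `f` near `0` comes from an eigenvalue of `M` on the unit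
circle, so `z` is real and `ζ` lies on a coordinate axis. Since `f` is not even, reflection excludes
real values on the positive imaginary axis near `0`. So `Im f` has no zero on a small upper half
disc, whereas `f'(0) = 0` would make it take both signs there
(`AnalyticAt.deriv_ne_zero_of_real_imp`). Hence `f'(0) ≠ 0`, the odd part has order one, and `m =
0`. -/

/-! ### Analytic germs at the origin: reflection and parity. -/

theorem tendsto_ofReal_nhdsGT_zero : Tendsto ((↑) : ℝ → ℂ) (𝓝[>] 0) (𝓝[≠] 0) := by
  refine tendsto_nhdsWithin_iff.mpr ⟨?_, ?_⟩
  · have h : Tendsto ((↑) : ℝ → ℂ) (𝓝 0) (𝓝 ((0 : ℝ) : ℂ)) := continuous_ofReal.tendsto 0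
    rw [ofReal_zero] at h
    exact h.mono_left nhdsWithin_le_nhds
  · filter_upwards [self_mem_nhdsWithin] with t ht
    exact ofReal_ne_zero.mpr (ne_of_gt ht)

/-- Two analytic germs at `0` which agree at arbitrarily small positive reals are equal. -/
theorem AnalyticAt.eventually_eq_of_frequently_ofReal {f g : ℂ → ℂ} (hf : AnalyticAt ℂ f 0)
    (hg : AnalyticAt ℂ g 0) (h : ∃ᶠ t : ℝ in 𝓝[>] 0, f t = g t) : ∀ᶠ z in 𝓝 0, f z = g z :=
  (hf.frequently_eq_iff_eventually_eq hg).mp (tendsto_ofReal_nhdsGT_zero.frequently h)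

theorem AnalyticAt.conj_conj_zero {f : ℂ → ℂ} (hf : AnalyticAt ℂ f 0) :
    AnalyticAt ℂ (fun z => (starRingEnd ℂ) (f ((starRingEnd ℂ) z))) 0 := by
  rw [analyticAt_iff_eventually_differentiableAt] at hf ⊢
  have hc : Tendsto (starRingEnd ℂ) (𝓝 0) (𝓝 0) := by
    simpa using (continuous_conj.tendsto (0 : ℂ))
  filter_upwards [hc.eventually hf] with z hz
  simpa [Function.comp_def] using hz.conj_conj

/-- The Schwarz reflection principle for germs. -/
theorem AnalyticAt.eventually_conj_conj_eq {f : ℂ → ℂ} (hf : AnalyticAt ℂ f 0)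
    (h : ∀ᶠ t : ℝ in 𝓝[>] 0, (f t).im = 0) :
    ∀ᶠ z in 𝓝 0, (starRingEnd ℂ) (f ((starRingEnd ℂ) z)) = f z := by
  refine hf.conj_conj_zero.eventually_eq_of_frequently_ofReal hf (Eventually.frequently ?_)
  filter_upwards [h] with t ht
  rw [conj_ofReal]
  exact conj_eq_iff_im.mpr ht

theorem AnalyticAt.comp_const_mul_zero {f : ℂ → ℂ} (hf : AnalyticAt ℂ f 0) (c : ℂ) :
    AnalyticAt ℂ (fun z => f (c * z)) 0 := by
  have h0 : c * (0 : ℂ) = 0 := mul_zero c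
  exact AnalyticAt.fun_comp (h0.symm ▸ hf) (by fun_prop)

theorem tendsto_const_mul_nhds_zero (c : ℂ) : Tendsto (fun z => c * z) (𝓝 0) (𝓝 0) := by
  simpa using (continuous_const_mul c).tendsto (0 : ℂ)

/-- A germ that is real on two rays is invariant under the composition of the two reflections. -/
theorem AnalyticAt.eventually_eq_of_real_on_rays {f : ℂ → ℂ} (hf : AnalyticAt ℂ f 0) {ω : ℂ}
    (hω : (starRingEnd ℂ) ω * ω = 1) (h₁ : ∀ᶠ t : ℝ in 𝓝[>] 0, (f t).im = 0)
    (h₂ : ∀ᶠ t : ℝ in 𝓝[>] 0, (f (ω * t)).im = 0) : ∀ᶠ z in 𝓝 0, f (ω ^ 2 * z) = f z := by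
  have e₁ := hf.eventually_conj_conj_eq h₁
  have e₂ := (hf.comp_const_mul_zero ω).eventually_conj_conj_eq h₂
  -- The reflection identity of `f (ω * ·)` is read at `ω * z`; there `conj ω * ω = 1` leaves `conj
  -- (f (conj z)) = f (ω ^ 2 * z)`.
  filter_upwards [e₁, (tendsto_const_mul_nhds_zero ω).eventually e₂] with z h₁ h₂
  rw [map_mul, ← mul_assoc, mul_comm ω, hω, one_mul, ← mul_assoc, ← sq] at h₂
  rw [← h₂, h₁]

/-- The order of the odd part of a germ is odd. -/
theorem AnalyticAt.exists_analyticOrderAt_sub_neg {f : ℂ → ℂ} (hf : AnalyticAt ℂ f 0)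
    (hne : ¬ ∀ᶠ z in 𝓝 0, f (-z) = f z) :
    ∃ m : ℕ, analyticOrderAt (fun z => f z - f (-z)) 0 = ((2 * m + 1 : ℕ) : ℕ∞) := by
  have hneg : AnalyticAt ℂ (fun z => f (-z)) 0 := by simpa using hf.comp_const_mul_zero (-1)
  have hO : AnalyticAt ℂ (fun z => f z - f (-z)) 0 := hf.fun_sub hneg
  have htop : analyticOrderAt (fun z => f z - f (-z)) 0 ≠ ⊤ := by
    intro h
    refine hne ((analyticOrderAt_eq_top.mp h).mono fun z hz => ?_)
    linear_combination -hz
  obtain ⟨n, hn⟩ := ENat.ne_top_iff_exists.mp htop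
  obtain ⟨g, hg, hg0, hfg⟩ := hO.analyticOrderAt_eq_natCast.mp hn.symm
  -- For even `n`, oddness of the difference passes to `g`, forcing `g 0 = 0`.
  rcases Nat.even_or_odd n with he | ⟨m, rfl⟩
  · exfalso
    have ht : Tendsto (fun z : ℂ => -z) (𝓝 0) (𝓝 0) := by simpa using (continuous_neg.tendsto (0:ℂ))
    have key : ∃ᶠ z in 𝓝[≠] (0 : ℂ), g z + g (-z) = 0 := by
      refine Eventually.frequently ?_
      filter_upwards [hfg.filter_mono nhdsWithin_le_nhds,
        (ht.eventually hfg).filter_mono nhdsWithin_le_nhds, self_mem_nhdsWithin] with z h1 h2 hz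
      simp only [sub_zero, smul_eq_mul, neg_neg, he.neg_pow] at h1 h2
      refine (mul_eq_zero.mp (?_ : z ^ n * (g z + g (-z)) = 0)).resolve_left (pow_ne_zero _ hz)
      linear_combination -h1 - h2
    have hgn : AnalyticAt ℂ (fun z => g (-z)) 0 := by simpa using hg.comp_const_mul_zero (-1)
    have h3 := ((hg.fun_add hgn).frequently_zero_iff_eventually_zero.mp key).self_of_nhds
    simp only [neg_zero] at h3
    exact hg0 (by linear_combination h3 / 2)
  · exact ⟨m, hn.symm⟩

/-- The odd part of a germ with a nonzero derivative has order one. -/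
theorem AnalyticAt.analyticOrderAt_sub_neg_eq_one {f : ℂ → ℂ} (hf : AnalyticAt ℂ f 0)
    (hd : deriv f 0 ≠ 0) : analyticOrderAt (fun z => f z - f (-z)) 0 = 1 := by
  have hneg : AnalyticAt ℂ (fun z => f (-z)) 0 := by simpa using hf.comp_const_mul_zero (-1)
  refine (hf.fun_sub hneg).analyticOrderAt_eq_one_of_zero_deriv_ne_zero (by simp) ?_
  rw [deriv_fun_sub hf.differentiableAt hneg.differentiableAt, deriv_comp_neg, neg_zero]
  intro h
  exact hd (by linear_combination h / 2)

/-! ### Germs that are real only on the axes. -/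

/-- Along a ray `u` with `u ^ n = ± I`, the imaginary part of `z ^ n * g z` has the sign of
`± g 0`. -/
theorem eventually_im_pow_mul_pos {g : ℂ → ℂ} (hg : ContinuousAt g 0) {n : ℕ} {u : ℂ} {s c : ℝ}
    (hu : u ^ n = s * I) (hs : 0 < s * c * (g 0).re) :
    ∀ᶠ t : ℝ in 𝓝[>] 0, 0 < c * ((u * t) ^ n * g (u * t)).im := by
  have ht : Tendsto (fun t : ℝ => s * c * (g (u * t)).re) (𝓝[>] 0) (𝓝 (s * c * (g 0).re)) := by
    have h1 : Tendsto (fun t : ℝ => u * (t : ℂ)) (𝓝[>] 0) (𝓝 0) :=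
      (tendsto_const_mul_nhds_zero u).comp
        (tendsto_ofReal_nhdsGT_zero.mono_right nhdsWithin_le_nhds)
    exact ((continuous_re.tendsto _).comp (hg.tendsto.comp h1)).const_mul _
  filter_upwards [ht.eventually_const_lt hs, self_mem_nhdsWithin] with t h1 h2
  have : ((u * t) ^ n * g (u * t)).im = t ^ n * (s * (g (u * t)).re) := by
    rw [mul_pow, hu]
    have : (s : ℂ) * I * (t : ℂ) ^ n * g (u * t) = ((t ^ n * s : ℝ) : ℂ) * (I * g (u * t)) := by
      push_cast; ring
    rw [this, im_ofReal_mul, I_mul_im]; ring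
  rw [this]
  have h3 : (0 : ℝ) < t ^ n := pow_pos h2 n
  nlinarith [mul_pos h3 h1]

/-- The arguments `π/(2n)` and `3π/(2n)` both lie in `(0, π)` once `n ≥ 2`; for `n = 1` the second
one fails. -/
theorem exists_im_pos_pow_eq {n : ℕ} (hn : 2 ≤ n) :
    (∃ u : ℂ, 0 < u.im ∧ u ^ n = (1 : ℝ) * I) ∧ ∃ u : ℂ, 0 < u.im ∧ u ^ n = (-1 : ℝ) * I := by
  have hn' : (2 : ℝ) ≤ n := by exact_mod_cast hn
  have hn0 : (n : ℂ) ≠ 0 := by exact_mod_cast (by omega : n ≠ 0)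
  have hpi := Real.pi_pos
  constructor
  · refine ⟨exp ((Real.pi / (2 * n) : ℝ) * I), ?_, ?_⟩
    · rw [exp_ofReal_mul_I_im]
      refine Real.sin_pos_of_pos_of_lt_pi (by positivity) ?_
      rw [div_lt_iff₀ (by positivity)]
      nlinarith
    · have : (n : ℂ) * ((Real.pi / (2 * n) : ℝ) * I) = Real.pi / 2 * I := by
        push_cast
        field_simp
      rw [← exp_nat_mul, this, exp_pi_div_two_mul_I, ofReal_one, one_mul]
  · refine ⟨exp ((3 * Real.pi / (2 * n) : ℝ) * I), ?_, ?_⟩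
    · rw [exp_ofReal_mul_I_im]
      refine Real.sin_pos_of_pos_of_lt_pi (by positivity) ?_
      rw [div_lt_iff₀ (by positivity)]
      nlinarith
    · rw [← exp_nat_mul]
      have : (n : ℂ) * ((3 * Real.pi / (2 * n) : ℝ) * I) = Real.pi * I + Real.pi / 2 * I := by
        push_cast
        field_simp
        ring
      rw [this, exp_add, exp_pi_mul_I, exp_pi_div_two_mul_I]
      simp

/-- A germ that is real on the real axis, takes real values only on the two coordinate axes, and
is not even has a nonzero derivative. -/
theorem AnalyticAt.deriv_ne_zero_of_real_imp {f : ℂ → ℂ} (hf : AnalyticAt ℂ f 0)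
    (hne : ¬ ∀ᶠ z in 𝓝 0, f (-z) = f z) (hreal : ∀ᶠ t : ℝ in 𝓝[>] 0, (f t).im = 0)
    (himp : ∀ᶠ z in 𝓝 0, (f z).im = 0 → (z ^ 2).im = 0) : deriv f 0 ≠ 0 := by
  intro hd
  have hconj := hf.eventually_conj_conj_eq hreal
  have hf0 : (f 0).im = 0 := conj_eq_iff_im.mp (by simpa using hconj.self_of_nhds)
  -- on the positive imaginary axis the values are not real
  have himag : ∀ᶠ t : ℝ in 𝓝[>] 0, (f (I * t)).im ≠ 0 := by
    by_contra hcon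
    have hcon : ∃ᶠ t : ℝ in 𝓝[>] 0, (f (I * t)).im = 0 := by
      exact (not_eventually.mp hcon).mono fun t ht => not_not.mp ht
    -- By reflection, a real value at `I * t` equals the value at `-I * t`; if this happens
    -- arbitrarily near `0`, then `f` is even.
    have hfr : ∃ᶠ t : ℝ in 𝓝[>] 0, f (-I * t) = f (I * t) := by
      have hI : Tendsto (fun t : ℝ => I * (t : ℂ)) (𝓝[>] 0) (𝓝 0) :=
        (tendsto_const_mul_nhds_zero I).comp
          (tendsto_ofReal_nhdsGT_zero.mono_right nhdsWithin_le_nhds)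
      refine (hcon.and_eventually (hI.eventually hconj)).mono fun t ht => ?_
      have h2 := ht.2
      rw [map_mul, conj_I, conj_ofReal] at h2
      rw [conj_eq_iff_im.mpr ht.1 |>.symm, ← h2, Complex.conj_conj]
    have h3 := (hf.comp_const_mul_zero (-I)).eventually_eq_of_frequently_ofReal
      (hf.comp_const_mul_zero I) hfr
    refine hne (((tendsto_const_mul_nhds_zero (-I)).eventually h3).mono fun z hz => ?_)
    have e1 : -I * (-I * z) = -z := by linear_combination z * I_mul_I
    have e2 : I * (-I * z) = z := by linear_combination -z * I_mul_I
    rwa [e1, e2] at hz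
  -- the order of `f - f 0` is at least two
  have hsub : AnalyticAt ℂ (fun z => f z - f 0) 0 := hf.fun_sub analyticAt_const
  have htop : analyticOrderAt (fun z => f z - f 0) 0 ≠ ⊤ := by
    intro h
    have h1 := analyticOrderAt_eq_top.mp h
    have h2 := (tendsto_const_mul_nhds_zero (-1)).eventually h1
    refine hne ((h1.and h2).mono fun z hz => ?_)
    have := hz.2
    rw [neg_one_mul] at this
    linear_combination this - hz.1
  obtain ⟨n, hn⟩ := ENat.ne_top_iff_exists.mp htop
  have hn2 : 2 ≤ n := by
    have h1 := hf.analyticOrderAt_deriv_add_one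
    have h2 : analyticOrderAt (deriv f) 0 ≠ 0 := hf.deriv.analyticOrderAt_ne_zero.mpr hd
    have h3 : 1 ≤ analyticOrderAt (deriv f) 0 := Order.one_le_iff_ne_zero.mpr h2
    have h4 : (1 : ℕ∞) + 1 ≤ n := by
      rw [hn, ← h1]
      gcongr
    exact_mod_cast h4
  obtain ⟨g, hg, hg0, hfg⟩ := hsub.analyticOrderAt_eq_natCast.mp hn.symm
  simp only [sub_zero, smul_eq_mul] at hfg
  have hgim : (g 0).im = 0 := by
    have ht : Tendsto (fun t : ℝ => (g t).im) (𝓝[>] 0) (𝓝 (g 0).im) :=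
      (continuous_im.tendsto _).comp (hg.continuousAt.tendsto.comp
        (tendsto_ofReal_nhdsGT_zero.mono_right nhdsWithin_le_nhds))
    refine tendsto_nhds_unique_of_eventuallyEq ht tendsto_const_nhds ?_
    filter_upwards [hreal, self_mem_nhdsWithin,
      (tendsto_ofReal_nhdsGT_zero.mono_right nhdsWithin_le_nhds).eventually hfg] with t h1 h2 h3
    have h4 := congrArg im h3
    rw [sub_im, h1, hf0, ← ofReal_pow, im_ofReal_mul, sub_zero] at h4
    exact (mul_eq_zero.mp h4.symm).resolve_left (pow_ne_zero _ (ne_of_gt h2))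
  have hgre : (g 0).re ≠ 0 := fun h => hg0 (Complex.ext h hgim)
  have hpos : 0 < (g 0).re * (g 0).re := mul_self_pos.mpr hgre
  -- a half disc on which the imaginary part does not vanish
  obtain ⟨δ, hδ, hδf⟩ := mem_nhdsGT_iff_exists_Ioo_subset.mp himag
  obtain ⟨ρ, hρ, hball⟩ := Metric.eventually_nhds_iff_ball.mp
    (himp.and (hfg.and (hf.eventually_analyticAt)))
  set S : Set ℂ := ball 0 (min ρ δ) ∩ {z | 0 < z.im} with hS
  have hSconv : Convex ℝ S := (convex_ball 0 _).inter (convex_halfSpace_im_gt 0)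
  have hSball : ∀ z ∈ S, z ∈ ball (0 : ℂ) ρ := fun z hz =>
    ball_subset_ball (min_le_left _ _) hz.1
  have hSne : ∀ z ∈ S, (f z).im ≠ 0 := by
    intro z hz h0
    have h1 := (hball z (hSball z hz)).1 h0
    have him : 0 < z.im := hz.2
    have hre : z.re = 0 := by
      rw [sq, mul_im] at h1
      have : z.re * z.im = 0 := by linarith
      exact (mul_eq_zero.mp this).resolve_right him.ne'
    have hzI : z = I * (z.im : ℂ) := by
      apply Complex.ext <;> simp [hre]
    have hlt : z.im < δ := by
      have h2 : ‖z‖ < min ρ δ := by simpa using hz.1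
      exact (le_abs_self _).trans_lt ((abs_im_le_norm z).trans_lt (h2.trans_le (min_le_right _ _)))
    have h3 : (f (I * (z.im : ℂ))).im ≠ 0 := hδf ⟨him, hlt⟩
    rw [← hzI] at h3
    exact h3 h0
  have hcont : ContinuousOn (fun z => (f z).im) S := fun z hz =>
    (continuous_im.continuousAt.comp
      (hball z (hSball z hz)).2.2.continuousAt).continuousWithinAt
  have hray : ∀ u : ℂ, ∀ s : ℝ, 0 < u.im → u ^ n = s * I → s * s = 1 →
      ∃ z ∈ S, 0 < s * (g 0).re * (f z).im := by
    intro u s hu hun hs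
    have h1 : ∀ᶠ t : ℝ in 𝓝[>] 0, u * t ∈ ball (0 : ℂ) (min ρ δ) :=
      ((tendsto_const_mul_nhds_zero u).comp
        (tendsto_ofReal_nhdsGT_zero.mono_right nhdsWithin_le_nhds)).eventually
        (ball_mem_nhds 0 (lt_min hρ hδ))
    obtain ⟨t, h2, h3, ht⟩ := ((eventually_im_pow_mul_pos hg.continuousAt (c := s * (g 0).re) hun
      (by nlinarith)).and (h1.and self_mem_nhdsWithin)).exists
    have hmem : u * t ∈ S := ⟨h3, by
      have : 0 < u.im * t := mul_pos hu ht
      simpa [mul_im] using this⟩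
    refine ⟨u * t, hmem, ?_⟩
    rw [← (hball _ (hSball _ hmem)).2.1, sub_im, hf0, sub_zero] at h2
    exact h2
  obtain ⟨⟨u₁, hu₁, hun₁⟩, u₂, hu₂, hun₂⟩ := exists_im_pos_pow_eq hn2
  obtain ⟨z₁, hz₁, hp₁⟩ := hray u₁ 1 hu₁ hun₁ (by norm_num)
  obtain ⟨z₂, hz₂, hp₂⟩ := hray u₂ (-1) hu₂ hun₂ (by norm_num)
  -- Opposite signs of `Im f` at `z₁` and `z₂` force a zero on the connected half disc.
  have hconn := (hSconv.isPreconnected.image _ hcont).ordConnected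
  have hzero : (0 : ℝ) ∈ (fun z => (f z).im) '' S := by
    rcases lt_or_gt_of_ne hgre with h | h
    · exact hconn.out ⟨z₁, hz₁, rfl⟩ ⟨z₂, hz₂, rfl⟩ ⟨by nlinarith, by nlinarith⟩
    · exact hconn.out ⟨z₂, hz₂, rfl⟩ ⟨z₁, hz₁, rfl⟩ ⟨by nlinarith, by nlinarith⟩
  obtain ⟨z, hz, hz0⟩ := hzero
  exact hSne z hz hz0

/-! ### The cut logarithm and the left half-plane. -/

theorem exp_cutLog {w : ℂ} (hw : w ≠ 0) : exp (cutLog w) = w := by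
  have h : -I * w ≠ 0 := mul_ne_zero (neg_ne_zero.mpr I_ne_zero) hw
  rw [cutLog, exp_add, exp_log h, exp_pi_div_two_mul_I]
  linear_combination -w * I_mul_I

theorem cutLog_ofReal {t : ℝ} (ht : 0 < t) : cutLog t = Real.log t := by
  rw [cutLog, mul_comm, log_ofReal_mul ht (neg_ne_zero.mpr I_ne_zero), log_neg_I]
  ring

theorem cutLog_neg_ofReal {t : ℝ} (ht : 0 < t) : cutLog (-t) = Real.log t + Real.pi * I := by
  have : -I * (-(t : ℂ)) = t * I := by ring
  rw [cutLog, this, log_ofReal_mul ht I_ne_zero, log_I]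
  ring

theorem ne_of_mem_cutDisc {c z : ℂ} {r : ℝ} (hz : z ∈ cutDisc c r) : z ≠ c := by
  rintro rfl
  exact hz.2 ⟨rfl, le_rfl⟩

theorem norm_exp_cutLog_lt {c z : ℂ} {r : ℝ} (hz : z ∈ cutDisc c r) :
    ‖exp (cutLog (z - c))‖ < r := by
  rw [exp_cutLog (sub_ne_zero.mpr (ne_of_mem_cutDisc hz))]
  exact hz.1

theorem add_ofReal_mem_cutDisc {c : ℂ} {r t : ℝ} (ht : t ≠ 0) (htr : |t| < r) :
    c + t ∈ cutDisc c r :=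
  ⟨by simpa using htr, fun h => ht (by simpa using h.1)⟩

theorem setOf_norm_exp_lt {r : ℝ} (hr : 0 < r) :
    {w : ℂ | ‖exp w‖ < r} = {w : ℂ | w.re < Real.log r} := by
  ext w
  simp only [Set.mem_ofPred_eq, norm_exp, Real.lt_log_iff_exp_lt hr]

theorem isOpen_setOf_norm_exp_lt (r : ℝ) : IsOpen {w : ℂ | ‖exp w‖ < r} :=
  isOpen_lt (by fun_prop) continuous_const

theorem isPreconnected_setOf_norm_exp_lt {r : ℝ} (hr : 0 < r) :
    IsPreconnected {w : ℂ | ‖exp w‖ < r} := by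
  rw [setOf_norm_exp_lt hr]
  exact (convex_halfSpace_re_lt _).isPreconnected

theorem norm_exp_add_imag (w : ℂ) (x : ℝ) : ‖exp (w + x * I)‖ = ‖exp w‖ := by
  rw [exp_add, norm_mul, norm_exp_ofReal_mul_I, mul_one]

theorem norm_exp_add_two_pi_mul (w : ℂ) (k : ℕ) :
    ‖exp (w + 2 * Real.pi * I * k)‖ = ‖exp w‖ := by
  rw [← norm_exp_add_imag w (2 * Real.pi * k)]
  push_cast
  ring_nf

/-! ### From periodic functions to power series. -/

/-- A bounded holomorphic function on a left half-plane, with the period `2πin`, is an analytic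
function of `exp (w / n)`. -/
theorem exists_analyticAt_comp_exp {G : ℂ → ℂ} {r : ℝ} {n : ℕ} (hn : 0 < n) (hr : 0 < r)
    (hG : DifferentiableOn ℂ G {w | ‖exp w‖ < r})
    (hper : ∀ w, ‖exp w‖ < r → G (w + 2 * Real.pi * I * n) = G w)
    {ρ C : ℝ} (hρ : 0 < ρ) (hb : ∀ w, ‖exp w‖ < ρ → ‖G w‖ ≤ C) :
    ∃ F : ℂ → ℂ, AnalyticAt ℂ F 0 ∧ ∀ w, ‖exp w‖ < r → G w = F (exp (w / n)) := by
  classical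
  have hn0 : (n : ℂ) ≠ 0 := by exact_mod_cast hn.ne'
  -- With `w = 2πi n u` the period becomes `1` and `exp (2πi u) = exp (w / n)`. The value `0` off
  -- the half-plane only keeps `f` periodic on all of `ℂ`.
  set f : ℂ → ℂ := fun u => if ‖exp (2 * Real.pi * I * n * u)‖ < r
    then G (2 * Real.pi * I * n * u) else 0 with hf
  have hshift : ∀ u : ℂ, 2 * Real.pi * I * n * (u + 1)
      = 2 * Real.pi * I * n * u + 2 * Real.pi * I * n := fun u => by ring
  have hfper : Function.Periodic f ((1 : ℝ) : ℂ) := by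
    intro u
    simp only [hf, ofReal_one, hshift, norm_exp_add_two_pi_mul]
    split_ifs with h
    · exact hper _ h
    · rfl
  have hnorm : ∀ u : ℂ, ‖exp (2 * Real.pi * I * n * u)‖ = Real.exp (-(2 * Real.pi * n * u.im)) := by
    intro u
    rw [norm_exp]
    congr 1
    have : 2 * Real.pi * I * n * u = ((2 * Real.pi * n : ℝ) : ℂ) * (I * u) := by push_cast; ring
    rw [this, re_ofReal_mul, I_mul_re]
    ring
  have hsmall : ∀ s : ℝ, 0 < s → ∀ᶠ u in comap im atTop, ‖exp (2 * Real.pi * I * n * u)‖ < s := by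
    intro s hs
    have ht : Tendsto (fun y : ℝ => Real.exp (-(2 * Real.pi * n * y))) atTop (𝓝 0) :=
      Real.tendsto_exp_neg_atTop_nhds_zero.comp
        (tendsto_id.const_mul_atTop (by have := Real.pi_pos; positivity))
    filter_upwards [tendsto_comap.eventually (ht.eventually (gt_mem_nhds hs))] with u hu
    rw [hnorm]
    exact hu
  have hhol : ∀ᶠ u in comap im atTop, DifferentiableAt ℂ f u := by
    filter_upwards [hsmall r hr] with u hu
    have hd : DifferentiableAt ℂ (fun u => G (2 * Real.pi * I * n * u)) u :=
      DifferentiableAt.fun_comp' u (hG.differentiableAt ((isOpen_setOf_norm_exp_lt r).mem_nhds hu))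
        (by fun_prop)
    refine hd.congr_of_eventuallyEq ?_
    have hc : Continuous fun u : ℂ => ‖exp (2 * Real.pi * I * n * u)‖ := by fun_prop
    filter_upwards [hc.continuousAt.eventually (gt_mem_nhds hu)] with v hv
    simp only [hf, if_pos hv]
  have hbd : BoundedAtFilter (comap im atTop) f := by
    refine Asymptotics.IsBigO.of_bound C ?_
    filter_upwards [hsmall r hr, hsmall ρ hρ] with u h1 h2
    simp only [hf, if_pos h1]
    simpa using hb _ h2
  refine ⟨Function.Periodic.cuspFunction 1 f, ?_, ?_⟩
  · rw [analyticAt_iff_eventually_differentiableAt, ← nhdsNE_sup_pure, eventually_sup]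
    refine ⟨Function.Periodic.eventually_differentiableAt_cuspFunction_nhds_ne_zero one_pos hfper
      hhol, ?_⟩
    exact Function.Periodic.differentiableAt_cuspFunction_zero one_pos hfper hhol hbd
  · intro w hw
    have h2pi := two_pi_I_ne_zero
    have e1 : 2 * Real.pi * I * n * (w / (2 * Real.pi * I * n)) = w :=
      mul_div_cancel₀ _ (mul_ne_zero h2pi hn0)
    have h1 := Function.Periodic.eq_cuspFunction one_ne_zero hfper (w / (2 * Real.pi * I * n))
    have e2 : Function.Periodic.qParam 1 (w / (2 * Real.pi * I * n)) = exp (w / n) := by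
      rw [Function.Periodic.qParam]
      congr 1
      rw [ofReal_one, div_one]
      field_simp
    rw [e2] at h1
    rw [h1]
    simp only [hf, e1, if_pos hw]

/-- If the germ `F` with `G w = F (exp (w / n))` is invariant under multiplication by
`exp (2πik / n)`, then `G` has the period `2πik`. -/
theorem periodic_of_eventually_eq {G F : ℂ → ℂ} {r : ℝ} {n k : ℕ} (hn : 0 < n) (hr : 0 < r)
    (hG : DifferentiableOn ℂ G {w | ‖exp w‖ < r})
    (hGF : ∀ w, ‖exp w‖ < r → G w = F (exp (w / n)))
    (hF : ∀ᶠ z in 𝓝 0, F (exp (2 * Real.pi * I / n) ^ k * z) = F z) :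
    ∀ w, ‖exp w‖ < r → G (w + 2 * Real.pi * I * k) = G w := by
  have hn0 : (n : ℂ) ≠ 0 := by exact_mod_cast hn.ne'
  have hopen := isOpen_setOf_norm_exp_lt r
  obtain ⟨δ, hδ, hball⟩ := Metric.eventually_nhds_iff_ball.mp hF
  have hd : DifferentiableOn ℂ (fun w => G (w + 2 * Real.pi * I * k)) {w | ‖exp w‖ < r} :=
    hG.comp (by fun_prop) fun w hw => by
      simpa only [Set.mem_ofPred_eq, norm_exp_add_two_pi_mul] using hw
  -- A base point far enough left that it lies in the half-plane and `exp (w / n)` is in the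
  -- `δ`-ball near it; the identity theorem does the rest.
  set x : ℝ := min (Real.log r) (n * Real.log δ) - 1 with hx
  have hxr : x < Real.log r := by have := min_le_left (Real.log r) (n * Real.log δ); linarith
  have hxδ : x < n * Real.log δ := by have := min_le_right (Real.log r) (n * Real.log δ); linarith
  have hx0 : (x : ℂ) ∈ {w : ℂ | ‖exp w‖ < r} := by
    rw [setOf_norm_exp_lt hr]
    simpa using hxr
  have hloc : (fun w => G (w + 2 * Real.pi * I * k)) =ᶠ[𝓝 (x : ℂ)] G := by
    have hre : ∀ᶠ w in 𝓝 (x : ℂ), w.re < n * Real.log δ :=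
      (continuous_re.tendsto _).eventually (gt_mem_nhds (by simpa using hxδ))
    filter_upwards [hopen.mem_nhds hx0, hre] with w hw hwδ
    have hw' : ‖exp (w + 2 * Real.pi * I * k)‖ < r := by rwa [norm_exp_add_two_pi_mul]
    have hlt : exp (w / n) ∈ ball (0 : ℂ) δ := by
      rw [mem_ball_zero_iff, norm_exp, div_natCast_re, ← Real.lt_log_iff_exp_lt hδ,
        div_lt_iff₀ (by exact_mod_cast hn)]
      linarith
    rw [hGF _ hw', hGF w hw, ← hball _ hlt, ← exp_nat_mul, ← exp_add]
    congr 2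
    field_simp
    ring
  intro w hw
  exact (hd.analyticOnNhd hopen).eqOn_of_preconnected_of_eventuallyEq (hG.analyticOnNhd hopen)
    (isPreconnected_setOf_norm_exp_lt hr) hx0 hloc hw

/-- An even germ is an analytic function of the square of the variable. -/
theorem AnalyticAt.exists_comp_sq {f : ℂ → ℂ} (hf : AnalyticAt ℂ f 0)
    (heven : ∀ᶠ z in 𝓝 0, f (-z) = f z) :
    ∃ D : ℂ → ℂ, AnalyticAt ℂ D 0 ∧ ∀ᶠ z in 𝓝 0, f z = D (z ^ 2) := by
  have hbound : ∀ᶠ z in 𝓝 0, ‖f z‖ < ‖f 0‖ + 1 :=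
    hf.continuousAt.norm.eventually (gt_mem_nhds (lt_add_one _))
  obtain ⟨δ, hδ, hball⟩ := Metric.eventually_nhds_iff_ball.mp
    (hf.eventually_analyticAt.and (heven.and hbound))
  have hmem : ∀ w : ℂ, ‖exp w‖ < δ ^ 2 → exp (w / 2) ∈ ball (0 : ℂ) δ := by
    intro w hw
    have h1 : exp w = exp (w / 2) ^ 2 := by rw [← exp_nat_mul]; congr 1; push_cast; ring
    rw [h1, norm_pow] at hw
    rw [mem_ball_zero_iff]
    exact lt_of_pow_lt_pow_left₀ 2 hδ.le hw
  -- Evenness of `f` is exactly the period `2πi` of `f (exp (w / 2))`.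
  obtain ⟨D, hD, hDf⟩ := exists_analyticAt_comp_exp (G := fun w => f (exp (w / 2))) (n := 1)
    one_pos (pow_pos hδ 2)
    (fun w hw => (DifferentiableAt.fun_comp' w (hball _ (hmem w hw)).1.differentiableAt
      (by fun_prop)).differentiableWithinAt)
    (fun w hw => by
      have h1 : (w + 2 * Real.pi * I * (1 : ℕ)) / 2 = w / 2 + Real.pi * I := by push_cast; ring
      change f (exp ((w + 2 * Real.pi * I * (1 : ℕ)) / 2)) = f (exp (w / 2))
      rw [h1, exp_add, exp_pi_mul_I, mul_neg_one]
      exact (hball _ (hmem w hw)).2.1)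
    (pow_pos hδ 2) (fun w hw => (hball _ (hmem w hw)).2.2.le)
  refine ⟨D, hD, ?_⟩
  have hDsq : AnalyticAt ℂ (fun z => D (z ^ 2)) 0 := by
    have h0 : (0 : ℂ) ^ 2 = 0 := by norm_num
    exact AnalyticAt.fun_comp (f := fun z : ℂ => z ^ 2) (h0.symm ▸ hD) (by fun_prop)
  refine (hf.frequently_eq_iff_eventually_eq hDsq).mp (Eventually.frequently ?_)
  filter_upwards [self_mem_nhdsWithin, nhdsWithin_le_nhds (ball_mem_nhds 0 hδ)] with z hz hzδ
  have hz0 : z ≠ 0 := hz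
  have h2 : exp (2 * Complex.log z) = z ^ 2 := by
    rw [two_mul, exp_add, exp_log hz0, sq]
  have h3 := hDf (2 * Complex.log z) (by
    rw [h2, norm_pow]
    exact pow_lt_pow_left₀ (mem_ball_zero_iff.mp hzδ) (norm_nonneg _) two_ne_zero)
  rwa [Nat.cast_one, div_one, h2, mul_div_cancel_left₀ _ two_ne_zero, exp_log hz0] at h3

/-! ### Zeros of `Φ` and eigenvalues of the monodromy matrix. -/

namespace IsMonodromy

variable {N : ℕ} {M : ℂ → Matrix (Fin N) (Fin N) ℂ}

theorem det_ne_zero (hM : IsMonodromy M) (z : ℂ) : (M z).det ≠ 0 := by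
  obtain ⟨J, hJ, h⟩ := hM.unitary_identity
  have hJ0 : J.det ≠ 0 := by
    have h1 := congrArg Matrix.det (Matrix.mem_unitaryGroup_iff.mp hJ)
    rw [Matrix.det_mul, Matrix.det_one] at h1
    exact left_ne_zero_of_mul (h1 ▸ one_ne_zero)
  intro h0
  have h2 := congrArg Matrix.det (h z)
  rw [Matrix.det_mul, Matrix.det_mul, h0, zero_mul, zero_mul] at h2
  exact hJ0 h2.symm

theorem continuous (hM : IsMonodromy M) : Continuous M :=
  continuous_matrix fun i j => (hM.entire i j).continuous

theorem continuous_lyapunovMatrix (hM : IsMonodromy M) : Continuous (lyapunovMatrix M) := by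
  have hinv : Continuous fun z => (M z)⁻¹ := by
    simp only [Matrix.inv_def, Ring.inverse_eq_inv']
    exact (hM.continuous.matrix_det.inv₀ hM.det_ne_zero).smul hM.continuous.matrix_adjugate
  exact (hM.continuous.add hinv).const_smul (1 / 2 : ℂ)

/-- The zeros of `Φ(·, z)` are locally bounded in `z`. -/
theorem exists_norm_le_of_lyapunovDet_eq_zero (hM : IsMonodromy M) (c : ℂ) :
    ∃ C : ℝ, ∀ z ∈ ball c 1, ∀ ν : ℂ, lyapunovDet M ν z = 0 → ‖ν‖ ≤ C := by
  open scoped Matrix.Norms.Operator in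
  obtain ⟨B, hB⟩ := (isCompact_closedBall c 1).exists_bound_of_continuousOn
    hM.continuous_lyapunovMatrix.continuousOn
  refine ⟨B * ‖(1 : Matrix (Fin N) (Fin N) ℂ)‖, fun z hz ν hν => ?_⟩
  have hmem : ν ∈ spectrum ℂ (lyapunovMatrix M z) := by
    rw [spectrum.mem_iff, Matrix.isUnit_iff_isUnit_det, isUnit_iff_ne_zero, not_not,
      ← neg_sub, Matrix.det_neg, Algebra.algebraMap_eq_smul_one]
    rw [lyapunovDet] at hν
    rw [hν, mul_zero]
  refine (spectrum.norm_le_norm_mul_of_mem hmem).trans ?_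
  gcongr
  exact hB z (ball_subset_closedBall hz)

/-- `Φ(·, z)` has a zero in `[-1, 1]` only for real `z`. -/
theorem im_eq_zero_of_lyapunovDet_eq_zero (hM : IsMonodromy M) {ν z : ℂ} (him : ν.im = 0)
    (h₁ : -1 ≤ ν.re) (h₂ : ν.re ≤ 1) (h : lyapunovDet M ν z = 0) : z.im = 0 := by
  set s : ℝ := Real.sqrt (1 - ν.re ^ 2) with hs
  have hs2 : s ^ 2 = 1 - ν.re ^ 2 := Real.sq_sqrt (by nlinarith)
  have hν : ν = (ν.re : ℂ) := Complex.ext rfl (by simpa using him)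
  have hunit : IsUnit (M z).det := isUnit_iff_ne_zero.mpr (hM.det_ne_zero z)
  have hs2' : (s : ℂ) ^ 2 = 1 - ν ^ 2 := by rw [hν]; exact_mod_cast hs2
  have hnorm : ∀ y : ℝ, y ^ 2 = s ^ 2 → ‖ν + y * I‖ = 1 := by
    intro y hy
    rw [hν, norm_add_mul_I, hy, hs2]
    simp
  have hspec : ∀ τ : ℂ, (M z - τ • 1).det = 0 → τ ∈ spectrum ℂ (M z) := by
    intro τ hτ
    rw [spectrum.mem_iff, Matrix.isUnit_iff_isUnit_det, isUnit_iff_ne_zero, not_not,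
      ← neg_sub, Matrix.det_neg, Algebra.algebraMap_eq_smul_one, hτ, mul_zero]
  -- `ν ± i s` are the roots of `τ² - 2ντ + 1`. As `ν ∈ [-1, 1]`, `s` is real and both roots have
  -- modulus one.
  have hfac : (2 : ℂ) • (M z * (lyapunovMatrix M z - ν • 1))
      = (M z - (ν + s * I) • 1) * (M z - (ν - s * I) • 1) := by
    have hone : (ν + s * I) * (ν - s * I) = 1 := by
      linear_combination hs2' - (s : ℂ) ^ 2 * I_sq
    have hL : M z * lyapunovMatrix M z = (1 / 2 : ℂ) • (M z * M z + 1) := by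
      rw [lyapunovMatrix, mul_smul_comm, mul_add, Matrix.mul_nonsing_inv _ hunit]
    have hR : ((ν + s * I) • (1 : Matrix (Fin N) (Fin N) ℂ)) * ((ν - s * I) • 1) = 1 := by
      rw [smul_mul_assoc, one_mul, smul_smul, hone, one_smul]
    rw [sub_mul, mul_sub, mul_sub (M z), mul_sub (_ • _), hR, hL, mul_smul_comm, mul_smul_comm,
      smul_mul_assoc, mul_one, one_mul]
    module
  have hdet := congrArg Matrix.det hfac
  rw [Matrix.det_smul, Matrix.det_mul, Matrix.det_mul, show
    (lyapunovMatrix M z - ν • (1 : Matrix (Fin N) (Fin N) ℂ)).det = 0 from h, mul_zero, mul_zero]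
    at hdet
  rcases mul_eq_zero.mp hdet.symm with h0 | h0
  · exact hM.real_of_norm_eq_one z _ (hspec _ h0) (hnorm s rfl)
  · refine hM.real_of_norm_eq_one z _ (hspec _ h0) ?_
    have := hnorm (-s) (by ring)
    rwa [ofReal_neg, neg_mul, ← sub_eq_add_neg] at this

end IsMonodromy

/-! ### The germ of a branch cycle and its real rays. -/

theorem AnalyticAt.analyticOrderAt_comp_sq {D : ℂ → ℂ} (hD : AnalyticAt ℂ D 0) :
    analyticOrderAt (fun z => D (z ^ 2)) 0 = analyticOrderAt D 0 * 2 := by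
  have h0 : (0 : ℂ) ^ 2 = 0 := by norm_num
  have h1 := AnalyticAt.analyticOrderAt_comp (f := D) (g := fun z : ℂ => z ^ 2) (z₀ := 0)
    (by simpa only [h0] using hD) (by fun_prop)
  have h2 : analyticOrderAt (fun z : ℂ => z ^ 2 - 0 ^ 2) 0 = 2 := by
    have := analyticOrderAt_centeredMonomial (𝕜 := ℂ) (z₀ := 0) (n := 2)
    simpa [Pi.pow_def] using this
  rw [h2] at h1
  simpa only [h0, Function.comp_def] using h1

theorem eventually_comp_neg_eq_of_const_mul {f : ℂ → ℂ} {c : ℂ} (hc : c ≠ 0)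
    (h : ∀ᶠ z in 𝓝 0, f (c * -z) = f (c * z)) : ∀ᶠ z in 𝓝 0, f (-z) = f z := by
  filter_upwards [(tendsto_const_mul_nhds_zero c⁻¹).eventually h] with z hz
  rwa [← mul_neg, mul_inv_cancel_left₀ hc, mul_inv_cancel_left₀ hc] at hz

/-- The germ of which the branches of a branch cycle are the Puiseux series. -/
theorem IsBranchCycle.exists_germ {N : ℕ} {M : ℂ → Matrix (Fin N) (Fin N) ℂ}
    (hM : IsMonodromy M) {z₀ : ℂ} {r : ℝ} (hr : 0 < r) {n : ℕ} {Δ : Fin n → ℂ → ℂ}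
    (hΔ : IsBranchCycle M z₀ r n Δ) :
    ∃ F : ℂ → ℂ, AnalyticAt ℂ F 0 ∧
      (∀ w, ‖exp w‖ < r → lyapunovDet M (F (exp (w / n))) (z₀ + exp w) = 0) ∧
      (∀ k : ℕ, 0 < k → k < n →
        ¬ ∀ᶠ z in 𝓝 0, F (exp (2 * Real.pi * I / n) ^ k * z) = F z) ∧
      (∀ j : Fin n, ∀ z ∈ cutDisc z₀ r,
        Δ j z = F (exp (2 * Real.pi * I / n) ^ (j : ℕ) * exp (cutLog (z - z₀) / n))) := by
  obtain ⟨hn2, G, hG, hzero, hper, hmin, hbr⟩ := hΔ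
  have hn : 0 < n := by omega
  have hn0 : (n : ℂ) ≠ 0 := by exact_mod_cast hn.ne'
  obtain ⟨C, hC⟩ := hM.exists_norm_le_of_lyapunovDet_eq_zero z₀
  -- The bound `C` holds within distance `1` of `z₀`, hence the minimum.
  obtain ⟨F, hF, hGF⟩ := exists_analyticAt_comp_exp hn hr hG hper (lt_min hr one_pos)
    (fun w hw => hC (z₀ + exp w) (by simpa using hw.trans_le (min_le_right _ _)) _
      (hzero w (hw.trans_le (min_le_left _ _))))
  refine ⟨F, hF, fun w hw => hGF w hw ▸ hzero w hw, fun k hk hkn h => ?_, fun j z hz => ?_⟩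
  · obtain ⟨w, hw, hne⟩ := hmin k hk hkn
    exact hne (periodic_of_eventually_eq hn hr hG hGF h w hw)
  · rw [hbr j z hz, hGF _ (by
      rw [norm_exp_add_two_pi_mul]; exact norm_exp_cutLog_lt hz), ← exp_nat_mul, ← exp_add]
    congr 2
    field_simp
    ring

/-- The side of `z₀` on which the branches are real is written as `z₀ + σ s` with `s > 0`, where
`σ = exp (iθ)` is `1` or `-1`. -/
theorem exists_side_real {z₀ : ℝ} {n : ℕ} {Δ : Fin n → ℂ → ℂ}
    (hreal : ∃ ε : ℝ, 0 < ε ∧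
      ((∀ j : Fin n, ∀ x ∈ Set.Ioo z₀ (z₀ + ε), (Δ j (x : ℂ)).im = 0) ∨
        (∀ j : Fin n, ∀ x ∈ Set.Ioo (z₀ - ε) z₀, (Δ j (x : ℂ)).im = 0))) :
    ∃ σ θ : ℝ, |σ| = 1 ∧ exp (θ * I) = σ ∧
      (∀ s : ℝ, 0 < s → cutLog ((σ * s : ℝ) : ℂ) = Real.log s + θ * I) ∧
      ∀ j, ∀ᶠ s : ℝ in 𝓝[>] 0, (Δ j ((z₀ : ℂ) + (σ * s : ℝ))).im = 0 := by
  obtain ⟨ε, hε, h | h⟩ := hreal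
  · refine ⟨1, 0, by simp, by simp, fun s hs => by simpa using cutLog_ofReal hs, fun j => ?_⟩
    filter_upwards [Ioo_mem_nhdsGT hε] with s hs
    rw [one_mul, ← ofReal_add]
    exact h j _ ⟨by linarith [hs.1], by linarith [hs.2]⟩
  · refine ⟨-1, Real.pi, by simp, by simp, fun s hs => by simpa using cutLog_neg_ofReal hs,
      fun j => ?_⟩
    filter_upwards [Ioo_mem_nhdsGT hε] with s hs
    rw [neg_one_mul, ← ofReal_add]
    exact h j _ ⟨by linarith [hs.2], by linarith [hs.1]⟩

theorem tendsto_pow_nhdsGT_zero {n : ℕ} (hn : n ≠ 0) :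
    Tendsto (fun t : ℝ => t ^ n) (𝓝[>] 0) (𝓝[>] 0) := by
  refine tendsto_nhdsWithin_iff.mpr ⟨?_, ?_⟩
  · have : Tendsto (fun t : ℝ => t ^ n) (𝓝 0) (𝓝 (0 ^ n)) := (continuous_pow n).tendsto 0
    rw [zero_pow hn] at this
    exact this.mono_left nhdsWithin_le_nhds
  · filter_upwards [self_mem_nhdsWithin] with t ht
    exact pow_pos (Set.mem_Ioi.mp ht) n

/-- Parametrising the real side by `t ^ n` makes the chosen `n`-th root linear in `t`, so it traces
the ray through `exp (iθ/n)`. -/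
theorem exp_cutLog_mul_pow_div {σ θ t : ℝ} {n : ℕ} (hn : n ≠ 0) (ht : 0 < t)
    (hlog : ∀ s : ℝ, 0 < s → cutLog ((σ * s : ℝ) : ℂ) = Real.log s + θ * I) :
    exp (cutLog ((σ * t ^ n : ℝ) : ℂ) / n) = exp (θ * I / n) * t := by
  have hn0 : (n : ℂ) ≠ 0 := by exact_mod_cast hn
  rw [hlog _ (pow_pos ht n), Real.log_pow]
  have : ((n * Real.log t : ℝ) + θ * I) / n = θ * I / n + Real.log t := by
    push_cast; field_simp; ring
  rw [this, exp_add, ← ofReal_exp, Real.exp_log ht]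

theorem eventually_add_mul_pow_mem_cutDisc (c : ℂ) {r σ : ℝ} (hr : 0 < r) (hσ : |σ| = 1) {n : ℕ}
    (hn : n ≠ 0) : ∀ᶠ t : ℝ in 𝓝[>] 0, c + (σ * t ^ n : ℝ) ∈ cutDisc c r := by
  filter_upwards [self_mem_nhdsWithin, (tendsto_pow_nhdsGT_zero hn).eventually
    (Ioo_mem_nhdsGT hr)] with t ht htr
  refine add_ofReal_mem_cutDisc (mul_ne_zero ?_ (pow_ne_zero _ (ne_of_gt ht))) ?_
  · rintro rfl
    simp at hσ
  · rw [abs_mul, hσ, one_mul, abs_of_pos htr.1]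
    exact htr.2

theorem eventually_branch_eq {F f : ℂ → ℂ} {c u : ℂ} {r σ θ : ℝ} {n : ℕ} (hr : 0 < r)
    (hσ : |σ| = 1) (hn : n ≠ 0)
    (hlog : ∀ s : ℝ, 0 < s → cutLog ((σ * s : ℝ) : ℂ) = Real.log s + θ * I)
    (hf : ∀ z ∈ cutDisc c r, f z = F (u * exp (cutLog (z - c) / n))) :
    ∀ᶠ t : ℝ in 𝓝[>] 0, f (c + (σ * t ^ n : ℝ)) = F (exp (θ * I / n) * (u * t)) := by
  filter_upwards [self_mem_nhdsWithin, eventually_add_mul_pow_mem_cutDisc c hr hσ hn] with t ht hmem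
  rw [hf _ hmem, add_sub_cancel_left, exp_cutLog_mul_pow_div hn ht hlog]
  ring_nf

/-! ### The branch point theorem. -/

theorem theorem1p2 {N : ℕ} (hN : 2 ≤ N) (M : ℂ → Matrix (Fin N) (Fin N) ℂ)
    (hM : IsMonodromy M) (z₀ : ℝ) (r : ℝ) (hr : 0 < r) (ϰ : ℕ) (Δ : Fin ϰ → ℂ → ℂ)
    (hΔ : IsBranchCycle M (z₀ : ℂ) r ϰ Δ)
    (hreal : ∃ ε : ℝ, 0 < ε ∧
      ((∀ j : Fin ϰ, ∀ x ∈ Set.Ioo z₀ (z₀ + ε), (Δ j (x : ℂ)).im = 0) ∨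
        (∀ j : Fin ϰ, ∀ x ∈ Set.Ioo (z₀ - ε) z₀, (Δ j (x : ℂ)).im = 0))) :
    ϰ = 2 ∧
    (∀ j : Fin ϰ, HasBranchPointOfOrderOneOver (Δ j) (z₀ : ℂ) 2) ∧
    ∃ m : ℕ,
      (∀ i j : Fin ϰ, i ≠ j → ∃ ρ : ℝ, 0 < ρ ∧ ∃ D : ℂ → ℂ,
        AnalyticOnNhd ℂ D (Metric.ball (z₀ : ℂ) ρ) ∧
        (∀ z ∈ cutDisc (z₀ : ℂ) ρ, D z = (Δ i z - Δ j z) ^ 2) ∧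
        analyticOrderAt D (z₀ : ℂ) = ((2 * m + 1 : ℕ) : ℕ∞)) ∧
      ((∃ j : Fin ϰ, ∃ c ∈ Set.Ioo (-1 : ℝ) 1,
          Filter.Tendsto (Δ j) (nhdsWithin (z₀ : ℂ) (cutDisc (z₀ : ℂ) r)) (nhds (c : ℂ))) →
        m = 0) := by
  have hϰ := hΔ.1
  obtain ⟨F, hF, hzero, hmin, hbr⟩ := hΔ.exists_germ hM hr
  obtain ⟨σ, θ, hσ, hθ, hlog, hside⟩ := exists_side_real hreal
  have hbranch := fun j => eventually_branch_eq hr hσ (by omega : ϰ ≠ 0) hlog (hbr j)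
  have hrays : ∀ j : Fin ϰ, ∀ᶠ t : ℝ in 𝓝[>] 0,
      (F (exp (θ * I / ϰ) * (exp (2 * Real.pi * I / ϰ) ^ (j : ℕ) * t))).im = 0 := by
    intro j
    filter_upwards [hbranch j, (tendsto_pow_nhdsGT_zero (by omega : ϰ ≠ 0)).eventually (hside j)]
      with t h1 h2
    rw [← h1]
    exact h2
  have hη0 := exp_ne_zero (θ * I / ϰ)
  have hFη := hF.comp_const_mul_zero (exp (θ * I / ϰ))
  -- For `ϰ > 2`, reality of branches `0` and `1` gives invariance under `ω ^ 2`, contradicting that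
  -- two turns do not restore the function.
  obtain rfl : ϰ = 2 := by
    by_contra hne
    refine hmin 2 two_pos (by omega) ?_
    have hω : (starRingEnd ℂ) (exp (2 * Real.pi * I / ϰ)) * exp (2 * Real.pi * I / ϰ) = 1 := by
      rw [← exp_conj, ← exp_add, ← exp_zero]
      congr 1
      simp only [map_div₀, map_mul, map_ofNat, conj_ofReal, conj_I, map_natCast]
      ring
    have h2 := hFη.eventually_eq_of_real_on_rays hω
      (by simpa using hrays ⟨0, by omega⟩) (by simpa using hrays ⟨1, by omega⟩)
    filter_upwards [(tendsto_const_mul_nhds_zero (exp (θ * I / ϰ))⁻¹).eventually h2] with z hz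
    rwa [mul_left_comm (_ ^ 2), mul_inv_cancel_left₀ hη0, mul_inv_cancel_left₀ hη0] at hz
  have hω : exp (2 * Real.pi * I / (2 : ℕ)) = -1 := by
    rw [← exp_pi_mul_I]
    congr 1
    push_cast
    ring
  simp only [hω] at hmin hbr hrays hbranch
  have hne : ¬ ∀ᶠ z in 𝓝 0, F (-z) = F z := by simpa using hmin 1 one_pos one_lt_two
  set η := exp (θ * I / (2 : ℕ))
  refine ⟨rfl, fun j => ⟨le_rfl, ⟨fun z => F ((-1) ^ (j : ℕ) * z), hF.comp_const_mul_zero _, r, hr,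
    hbr j⟩, fun q hq hq2 hP => ?_⟩, ?_⟩
  · -- a power series in `z - z₀` would make the germ even
    obtain rfl : q = 1 := by omega
    obtain ⟨P, hP, ρ, hρ, hPeq⟩ := hP
    have hc0 : η * (-1) ^ (j : ℕ) ≠ 0 := mul_ne_zero hη0 (pow_ne_zero _ (by norm_num))
    have hPσ : AnalyticAt ℂ (fun z => P (σ * z ^ 2)) 0 := by
      have h0 : (σ : ℂ) * 0 ^ 2 = 0 := by norm_num
      exact AnalyticAt.fun_comp (f := fun z : ℂ => (σ : ℂ) * z ^ 2) (h0.symm ▸ hP) (by fun_prop)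
    have h1 := (hF.comp_const_mul_zero (η * (-1) ^ (j : ℕ))).eventually_eq_of_frequently_ofReal hPσ
      (Eventually.frequently (by
        filter_upwards [hbranch j, eventually_add_mul_pow_mem_cutDisc (z₀ : ℂ) hρ hσ two_ne_zero,
          self_mem_nhdsWithin] with t h1 h2 ht
        have ht0 : t ≠ 0 := ne_of_gt ht
        have hσ0 : σ ≠ 0 := by rintro rfl; simp at hσ
        rw [mul_assoc, ← h1, hPeq _ h2, add_sub_cancel_left, Nat.cast_one, div_one,
          exp_cutLog (ofReal_ne_zero.mpr (by positivity))]
        push_cast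
        rfl))
    have h2 := (tendsto_const_mul_nhds_zero (-1)).eventually h1
    refine hne (eventually_comp_neg_eq_of_const_mul hc0 ((h1.and h2).mono fun z hz => ?_))
    have h3 := hz.2
    rw [neg_one_mul, neg_sq] at h3
    rw [h3, hz.1]
  · obtain ⟨m, hm⟩ := hF.exists_analyticOrderAt_sub_neg hne
    have hneg : AnalyticAt ℂ (fun z => F (-z)) 0 := by simpa using hF.comp_const_mul_zero (-1)
    have hO : AnalyticAt ℂ (fun z => F z - F (-z)) 0 := hF.fun_sub hneg
    refine ⟨m, fun i j hij => ?_, ?_⟩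
    · obtain ⟨D, hD, hDeq⟩ := (hO.fun_pow 2).exists_comp_sq (Eventually.of_forall fun z => by
        rw [neg_neg]; ring)
      have hDorder : analyticOrderAt D 0 = ((2 * m + 1 : ℕ) : ℕ∞) := by
        have h1 := analyticOrderAt_congr hDeq
        rw [hD.analyticOrderAt_comp_sq] at h1
        have h2 := analyticOrderAt_pow hO 2
        rw [hm, Pi.pow_def, h1] at h2
        have htop : analyticOrderAt D 0 ≠ ⊤ := by
          intro h
          rw [h, nsmul_eq_mul] at h2
          exact absurd h2 (by norm_cast)
        obtain ⟨k, hk⟩ := ENat.ne_top_iff_exists.mp htop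
        rw [← hk] at h2 ⊢
        rw [nsmul_eq_mul] at h2
        have h3 : k * 2 = 2 * (2 * m + 1) := by exact_mod_cast h2
        congr 1
        omega
      obtain ⟨δ, hδ, hδeq⟩ := Metric.eventually_nhds_iff_ball.mp hDeq
      obtain ⟨ρ, hρ, hρan⟩ := Metric.eventually_nhds_iff_ball.mp hD.eventually_analyticAt
      -- The radius `δ ^ 2` appears because `ζ ^ 2 = z - z₀` and `ζ` must stay in the `δ`-ball.
      refine ⟨min r (min ρ (δ ^ 2)), lt_min hr (lt_min hρ (pow_pos hδ 2)), fun z => D (z - z₀),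
        fun z hz => ?_, fun z hz => ?_, ?_⟩
      · have h1 : z - z₀ ∈ ball (0 : ℂ) ρ := by
          rw [mem_ball_zero_iff, ← dist_eq_norm]
          exact (mem_ball.mp hz).trans_le ((min_le_right _ _).trans (min_le_left _ _))
        exact AnalyticAt.fun_comp (f := fun z : ℂ => z - z₀) (hρan _ h1) (by fun_prop)
      · have hzr : z ∈ cutDisc (z₀ : ℂ) r := ⟨hz.1.trans_le (min_le_left _ _), hz.2⟩
        set ζ := exp (cutLog (z - z₀) / (2 : ℕ)) with hζ
        have hζ2 : ζ ^ 2 = z - z₀ := by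
          rw [hζ, ← exp_nat_mul, mul_div_cancel₀ _ (by norm_num),
            exp_cutLog (sub_ne_zero.mpr (ne_of_mem_cutDisc hz))]
        have hζδ : ζ ∈ ball (0 : ℂ) δ := by
          rw [mem_ball_zero_iff]
          refine lt_of_pow_lt_pow_left₀ 2 hδ.le ?_
          rw [← norm_pow, hζ2]
          exact hz.1.trans_le ((min_le_right _ _).trans (min_le_right _ _))
        have h1 := hδeq ζ hζδ
        rw [hζ2] at h1
        simp only [← h1]
        rw [hbr i z hzr, hbr j z hzr, ← hζ]
        fin_cases i <;> fin_cases j <;> simp at hij ⊢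
        ring
      · have h1 := analyticOrderAt_comp_of_deriv_ne_zero (f := D) (g := fun z : ℂ => z - z₀)
          (z₀ := (z₀ : ℂ)) (by fun_prop) (by simp)
        rw [sub_self, hDorder] at h1
        exact h1
    · rintro ⟨j, c, hc, hlim⟩
      have hF0 : F 0 = c := by
        have h1 : Tendsto (fun t : ℝ => (z₀ : ℂ) + (σ * t ^ 2 : ℝ)) (𝓝[>] 0)
            (𝓝[cutDisc (z₀ : ℂ) r] (z₀ : ℂ)) := by
          refine tendsto_nhdsWithin_iff.mpr
            ⟨?_, eventually_add_mul_pow_mem_cutDisc _ hr hσ two_ne_zero⟩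
          have h2 : Continuous fun t : ℝ => (z₀ : ℂ) + (σ * t ^ 2 : ℝ) := by fun_prop
          have h3 := h2.tendsto 0
          simp only [ne_eq, OfNat.ofNat_ne_zero, not_false_eq_true, zero_pow, mul_zero, ofReal_zero,
            add_zero] at h3
          exact h3.mono_left nhdsWithin_le_nhds
        have h4 : Tendsto (fun t : ℝ => F (η * ((-1) ^ (j : ℕ) * t))) (𝓝[>] 0) (𝓝 (F 0)) :=
          hF.continuousAt.tendsto.comp ((tendsto_const_mul_nhds_zero η).comp
            ((tendsto_const_mul_nhds_zero _).comp
              (tendsto_ofReal_nhdsGT_zero.mono_right nhdsWithin_le_nhds)))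
        exact tendsto_nhds_unique_of_eventuallyEq h4 (hlim.comp h1)
          ((hbranch j).mono fun t ht => ht.symm)
      have himp : ∀ᶠ z in 𝓝 0, (F (η * z)).im = 0 → (z ^ 2).im = 0 := by
        have hre : Tendsto (fun z => (F (η * z)).re) (𝓝 0) (𝓝 c) := by
          have := (continuous_re.tendsto _).comp (hF.continuousAt.tendsto.comp
            (tendsto_const_mul_nhds_zero η))
          rwa [hF0, ofReal_re] at this
        have hsq : ∀ᶠ z : ℂ in 𝓝 0, ‖(σ : ℂ) * z ^ 2‖ < r := by
          have h1 : Continuous fun z : ℂ => ‖(σ : ℂ) * z ^ 2‖ := by fun_prop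
          exact h1.continuousAt.eventually (gt_mem_nhds (by simpa using hr))
        filter_upwards [hre.eventually (Ioo_mem_nhds hc.1 hc.2), hsq] with z h1 h2 h3
        rcases eq_or_ne z 0 with rfl | hz
        · simp
        -- The half-plane point `2 log z + iθ` lies over `z₀ + σ z²`, and half of it exponentiates
        -- to `η z`; so `F (η z)` is a zero of `Φ` there, and reality of `z₀ + σ z²` is reality of
        -- `z²`.
        have e1 : exp (2 * log z + θ * I) = σ * z ^ 2 := by
          rw [exp_add, hθ, mul_comm]
          congr 1
          rw [two_mul, exp_add, exp_log hz, sq]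
        have e2 : exp ((2 * log z + θ * I) / (2 : ℕ)) = η * z := by
          have : (2 * log z + θ * I) / (2 : ℕ) = θ * I / (2 : ℕ) + log z := by push_cast; ring
          rw [this, exp_add, exp_log hz]
        have h4 := hzero (2 * log z + θ * I) (by rwa [e1])
        rw [e1, e2] at h4
        have h5 := hM.im_eq_zero_of_lyapunovDet_eq_zero h3 h1.1.le h1.2.le h4
        rw [add_im, ofReal_im, zero_add, im_ofReal_mul] at h5
        refine (mul_eq_zero.mp h5).resolve_left ?_
        rintro rfl
        simp at hσ
      have hneη : ¬ ∀ᶠ z in 𝓝 0, F (η * -z) = F (η * z) := fun h =>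
        hne (eventually_comp_neg_eq_of_const_mul hη0 h)
      have hd := hFη.deriv_ne_zero_of_real_imp hneη (by simpa using hrays 0) himp
      have hd' : deriv F 0 ≠ 0 := by
        rw [deriv_comp_mul_left, mul_zero, smul_eq_mul] at hd
        exact right_ne_zero_of_mul hd
      rw [hF.analyticOrderAt_sub_neg_eq_one hd'] at hm
      have h1 : 1 = 2 * m + 1 := by exact_mod_cast hm
      omega
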